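/- **Setting.** A three-stage EPIRK-$W$ method with simplified functions $\psi_j$ is given by real coefficients $a_{1,1},a_{2,1},a_{2,2}$, $b_1,b_2,b_3$, $g_{i,j}$ ($(i,j)\in\{(1,1),(2,1),(2,2),(3,1),(3,2),(3,3)\}$) and $p_{j,k}$ ($1\le k\le j\le 3$). Put $\varphi_k(z)=\sum_{i\ge 0} z^i/(i+k)!$ and $\psi_j(z)=\sum_{k=1}^{j}p_{j,k}\,\varphi_k(z)$. For $y'=f(y)$ in $\mathbb{R}^N$, a matrix $\mathbf A\in\mathbb{R}^{N\times N}$ (an arbitrary approximation of the Jacobian), and $r(Y)=f(Y)-f(y_n)-\mathbf A(Y-y_n)$, one step of size $h$ of the method is $$\begin{aligned} Y_1&=y_n+a_{1,1}\psi_1(g_{1,1}h\mathbf A)\,hf(y_n),\\ Y_2&=y_n+a_{2,1}\psi_1(g_{2,1}h\mathbf A)\,hf(y_n)+a_{2,2}\psi_2(g_{2,2}h\mathbf A)\,h\Delta^{(1)}r(y_n),\\ y_{n+1}&=y_n+b_1\psi_1(g_{3,1}h\mathbf A)\,hf(y_n)+b_2\psi_2(g_{3,2}h\mathbf A)\,h\Delta^{(1)}r(y_n)+b_3\psi_3(g_{3,3}h\mathbf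 A)\,h\Delta^{(2)}r(y_n), \end{aligned}$$ where $\Delta^{(1)}r(y_n)=r(Y_1)-r(y_n)$ and $\Delta^{(2)}r(y_n)=\bigl(r(Y_2)-r(Y_1)\bigr)-\bigl(r(Y_1)-r(y_n)\bigr)$. The method *has order $p$* if for all $N$, all smooth $f:\mathbb{R}^N\to\mathbb{R}^N$, all matrices $\mathbf A$ and all solutions $y$ of $y'=f(y)$ on an interval $[t_0,t_1]$ with $t_0<t_1$, one step of size $h$ from $y_n=y(t_0)$ gives $y_{n+1}-y(t_0+h)=O(h^{p+1})$ as $h\to 0^+$. $TW$-trees are rooted trees with meagre vertices (standing for $f$ and its derivatives) and fat vertices (standing for $\mathbf A$), each fat vertex having exactly one child. A B-series is $B(\mathsf a,y)=\mathsf a(\emptyset)y+\sum_{\tau\in TW}\mathsf a(\tau)\frac{h^{|\tau|}}{\sigma(\tau)}F(\tau)(y)$, with $|\tau|$ the number of vertices of $\tau$, $\sigma(\tau)$ its symmetry and $F(\tau)$ its elementary differential. The exact solution after one step has the coefficients $1/\gamma(\tau)$ if all vertices of $\tau$ are meagre ($\gamma(\tau)$ being the density) and $0$ otherwise; those of the numerical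 solution $y_{n+1}$ are obtained by carrying out the formulas of the method on B-series coefficients, starting from $y_n$ (coefficient $1$ at $\emptyset$, and $0$ elsewhere). The method *satisfies the order conditions up to order $p$* if the two sets of coefficients agree on all $TW$-trees with at most $p$ vertices. Let $\tau^W_{14}$ be the chain of four meagre vertices, with $F(\tau^W_{14})=f'f'f'f$. **Claim.** 1. For every choice of the coefficients, the coefficient of the numerical solution minus that of the exact solution at $\tau^W_{14}$ equals $-\tfrac1{24}$. 2. Hence no such method satisfies the order conditions up to order four, and no such method has order four. More generally, a method that satisfies the order conditions up to order $p$, or that has order $p$, has $p\le 3$. 3. There is a choice of the coefficients for which the method satisfies the order conditions up to order three and has order three. -/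

import Mathlib

open Filter Topology Asymptotics

open scoped ContDiff

/-- `TW`-trees: rooted trees with meagre (full) and fat (empty) vertices such that every fat vertex
has exactly one child; in particular all end vertices are meagre.  The children of a meagre vertex
are listed in some order; none of the notions below depends on that order. -/
inductive TWTree : Type
  | meagre (children : List TWTree) : TWTree
  | fat (child : TWTree) : TWTree

namespace TWTree

mutual
/-- The order `|τ|`: the number of vertices of `τ`. -/
def order : TWTree → ℕ
  | meagre ts => 1 + forestOrder ts
  | fat t => 1 + order t
/-- The total number of vertices of a list of trees. -/
def forestOrder : List TWTree → ℕ
  | [] => 0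
  | t :: ts => order t + forestOrder ts
end

mutual
/-- The density `γ(τ)`: the product, over all vertices, of the orders of the subtrees rooted at
those vertices. -/
def density : TWTree → ℕ
  | meagre ts => order (meagre ts) * forestDensity ts
  | fat t => order (fat t) * density t
/-- The product of the densities of a list of trees. -/
def forestDensity : List TWTree → ℕ
  | [] => 1
  | t :: ts => density t * forestDensity ts
end

mutual
/-- `τ ∈ T`: all vertices of `τ` are meagre. -/
def allMeagre : TWTree → Bool
  | meagre ts => forestAllMeagre ts
  | fat _ => false
/-- All vertices of all trees of the list are meagre. -/
def forestAllMeagre : List TWTree → Bool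
  | [] => true
  | t :: ts => allMeagre t && forestAllMeagre ts
end

/-- The tree `τ₁₄^W`: the chain of four meagre vertices, whose elementary differential is
`f' f' f' f`. -/
def tau14 : TWTree := meagre [meagre [meagre [meagre []]]]

end TWTree

/-- The real coefficients of an `EPIRK-W` method with three stages and simplified functions
`ψ_j = ∑_{k=1}^j p_{j,k} φ_k`. -/
structure EPIRKW3 where
  (a11 a21 a22 : ℝ)
  (b1 b2 b3 : ℝ)
  (g11 g21 g22 g31 g32 g33 : ℝ)
  (p11 p21 p22 p31 p32 p33 : ℝ)

namespace EPIRKW3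

/-- One step of the three-stage scheme, starting from `yn`, in a real vector space `V` in which the
operations of the scheme are available: `hf Y` is `h f(Y)`, `hA v` is `h A v`, and `phi k g v` is
`φ_k(g h A) v`.  It is used for vectors of `ℝ^N` and for coefficients of B-series. -/
def scheme {V : Type} [AddCommGroup V] [Module ℝ V] (c : EPIRKW3)
    (hf : V → V) (hA : V → V) (phi : ℕ → ℝ → V → V) (yn : V) : V :=
  let psi1 (g : ℝ) (v : V) : V := c.p11 • phi 1 g v
  let psi2 (g : ℝ) (v : V) : V := c.p21 • phi 1 g v + c.p22 • phi 2 g v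
  let psi3 (g : ℝ) (v : V) : V := c.p31 • phi 1 g v + c.p32 • phi 2 g v + c.p33 • phi 3 g v
  let hr (Y : V) : V := hf Y - hf yn - hA (Y - yn)
  let Y1 := yn + c.a11 • psi1 c.g11 (hf yn)
  let D1 := hr Y1 - hr yn
  let Y2 := yn + c.a21 • psi1 c.g21 (hf yn) + c.a22 • psi2 c.g22 D1
  let D2 := (hr Y2 - hr Y1) - (hr Y1 - hr yn)
  yn + c.b1 • psi1 c.g31 (hf yn) + c.b2 • psi2 c.g32 D1 + c.b3 • psi3 c.g33 D2

end EPIRKW3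

/-! ### B-series coefficients -/

namespace BSeries

open TWTree

/-- The coefficients `a : TW ∪ {∅} → ℝ` of a B-series
`a(∅) y + ∑_τ a(τ) h^|τ| / σ(τ) F(τ)(y)`; `none` stands for the empty tree. -/
abbrev Coeff : Type := Option TWTree → ℝ

/-- The coefficients of the current solution `y_n`. -/
def current : Coeff
  | none => 1
  | some _ => 0

/-- The coefficients of `h f(B(a, y))`, where `a(∅) = 1`: composition of B-series. -/
def compF (a : Coeff) : Coeff
  | none => 0
  | some (meagre ts) => (ts.map fun t => a (some t)).prod
  | some (fat _) => 0

/-- The coefficients of `h A B(a, y)`, where `a(∅) = 0`. -/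
def mulA (a : Coeff) : Coeff
  | none => 0
  | some (meagre _) => 0
  | some (fat t) => a (some t)

/-- The number of vertices of a tree or of the empty tree. -/
def size : Option TWTree → ℕ
  | none => 0
  | some t => t.order

/-- The coefficients of `φ_k(g h A) B(a, y) = ∑_i g^i / (i+k)! (h A)^i B(a, y)`, where `a(∅) = 0`.
On a tree `τ` the terms with `i > |τ|` vanish. -/
noncomputable def mulPhi (k : ℕ) (g : ℝ) (a : Coeff) : Coeff := fun τ =>
  ∑ i ∈ Finset.range (size τ + 1), g ^ i / ((i + k).factorial : ℝ) * (mulA^[i] a) τ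

/-- The coefficients of the B-series of the exact solution `y(t_n + h)`: `1 / γ(τ)` if all vertices
of `τ` are meagre, and `0` if `τ` has a fat vertex. -/
noncomputable def exact : Coeff
  | none => 1
  | some τ => if τ.allMeagre then 1 / (τ.density : ℝ) else 0

/-- The coefficients of the B-series of the numerical solution `y_{n+1}`. -/
noncomputable def numerical (c : EPIRKW3) : Coeff :=
  c.scheme compF mulA mulPhi current

end BSeries

namespace EPIRKW3

/-- The order conditions up to order `p`: the B-series coefficients of the numerical and of the
exact solution agree on all `TW`-trees with at most `p` vertices. -/
def OrderConditions (c : EPIRKW3) (p : ℕ) : Prop :=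
  ∀ τ : TWTree, τ.order ≤ p → BSeries.numerical c (some τ) = BSeries.exact (some τ)

end EPIRKW3

/-! ### The method applied to a differential equation -/

/-- The matrix function `φ_k(M) = ∑_{i ≥ 0} M^i / (i+k)!`. -/
noncomputable def phiFun {N : ℕ} (k : ℕ)
    (M : EuclideanSpace ℝ (Fin N) →L[ℝ] EuclideanSpace ℝ (Fin N)) :
    EuclideanSpace ℝ (Fin N) →L[ℝ] EuclideanSpace ℝ (Fin N) :=
  ∑' i : ℕ, (((i + k).factorial : ℝ)⁻¹) • M ^ i

namespace EPIRKW3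

/-- The numerical solution `y_{n+1}` after one step of size `h` from `yn`, for the differential
equation `y' = f(y)` in `ℝ^N` and the approximate Jacobian `A`. -/
noncomputable def step {N : ℕ} (c : EPIRKW3)
    (f : EuclideanSpace ℝ (Fin N) → EuclideanSpace ℝ (Fin N))
    (A : EuclideanSpace ℝ (Fin N) →L[ℝ] EuclideanSpace ℝ (Fin N)) (h : ℝ)
    (yn : EuclideanSpace ℝ (Fin N)) : EuclideanSpace ℝ (Fin N) :=
  c.scheme (fun Y => h • f Y) (fun v => h • A v) (fun k g v => phiFun k ((g * h) • A) v) yn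

/-- The `W`-method has order `p`: for every smooth problem `y' = f(y)` and every matrix `A` in place
of the Jacobian, the error after one step of size `h` is `O(h^(p+1))` as `h → 0`, `h > 0`. -/
def HasOrder (c : EPIRKW3) (p : ℕ) : Prop :=
  ∀ (N : ℕ) (f : EuclideanSpace ℝ (Fin N) → EuclideanSpace ℝ (Fin N))
    (A : EuclideanSpace ℝ (Fin N) →L[ℝ] EuclideanSpace ℝ (Fin N))
    (y : ℝ → EuclideanSpace ℝ (Fin N)) (t₀ t₁ : ℝ),
    ContDiff ℝ ∞ f → t₀ < t₁ →
    (∀ t ∈ Set.Icc t₀ t₁, HasDerivWithinAt y (f (y t)) (Set.Icc t₀ t₁) t) →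
    (fun h : ℝ => c.step f A h (y t₀) - y (t₀ + h)) =O[𝓝[>] 0] fun h : ℝ => h ^ (p + 1)

end EPIRKW3

-- A chain of four meagre vertices needs four nested evaluations of `f`, but the scheme only nests
-- three: `f(y_n)`, `f(Y₁)`, `f(Y₂)`. The functions `ψ_j` do not help, since at a tree with meagre
-- root they act as scalars. So the numerical coefficient at `tau14` is `0`, against `1/24`
-- (`numerical_tau14`, `exact_tau14`). The same obstruction appears analytically for `A = 0` and a
-- linear chain of four equations, where the error is exactly `-h⁴/24` in one component
-- (`step_chainField`).
--
-- Order three is attained by `thirdOrder`, which is Heun's method when `A = 0`. Its order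
-- conditions are a finite check on eight trees. Its actual order follows by expanding exact and
-- numerical solution to `O(h⁴)` for arbitrary `f` and `A`, and seeing that the expansions coincide
-- (`hasCubicExpansion_solution`, `hasCubicExpansion_thirdOrder`).

namespace TWTree

theorem order_pos (t : TWTree) : 0 < t.order := by
  cases t <;> simp [order]

/-- The `TW`-trees with at most three vertices. -/
theorem eq_of_order_le_three (t : TWTree) (ht : t.order ≤ 3) :
    t = meagre [] ∨ t = meagre [meagre []] ∨ t = fat (meagre []) ∨
    t = meagre [meagre [], meagre []] ∨ t = meagre [meagre [meagre []]] ∨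
    t = meagre [fat (meagre [])] ∨ t = fat (meagre [meagre []]) ∨
    t = fat (fat (meagre [])) := by
  have one (t : TWTree) (ht : t.order ≤ 1) : t = meagre [] := by
    rcases t with ⟨_ | ⟨s, ss⟩⟩ | s
    · rfl
    · have := s.order_pos; simp [order, forestOrder] at ht; omega
    · have := s.order_pos; simp [order] at ht; omega
  have two (t : TWTree) (ht : t.order ≤ 2) :
      t = meagre [] ∨ t = meagre [meagre []] ∨ t = fat (meagre []) := by
    rcases t with ⟨_ | ⟨s, _ | ⟨s', ss⟩⟩⟩ | s
    · simp
    · simp only [order, forestOrder] at ht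
      simp [one s (by omega)]
    · have := s.order_pos; have := s'.order_pos; simp only [order, forestOrder] at ht; omega
    · simp only [order] at ht
      simp [one s (by omega)]
  rcases t with ⟨_ | ⟨s, _ | ⟨s', _ | ⟨s'', ss⟩⟩⟩⟩ | s
  · simp
  · simp only [order, forestOrder] at ht
    rcases two s (by omega) with rfl | rfl | rfl <;> simp
  · have := s.order_pos; have := s'.order_pos; simp only [order, forestOrder] at ht
    simp [one s (by omega), one s' (by omega)]
  · have := s.order_pos; have := s'.order_pos; have := s''.order_pos
    simp only [order, forestOrder] at ht; omega
  · simp only [order] at ht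
    rcases two s (by omega) with rfl | rfl | rfl <;> simp

end TWTree

-- B-series coefficients at the chain of four vertices.

namespace BSeries

open TWTree

theorem mulA_iterate_succ_meagre (i : ℕ) (a : Coeff) (ts : List TWTree) :
    (mulA^[i + 1] a) (some (meagre ts)) = 0 := by
  rw [Function.iterate_succ_apply']; rfl

/-- At a tree with meagre root only the constant term of `φ_k` contributes. -/
theorem mulPhi_meagre (k : ℕ) (g : ℝ) (a : Coeff) (ts : List TWTree) :
    mulPhi k g a (some (meagre ts)) = a (some (meagre ts)) / (k.factorial : ℝ) := by
  rw [mulPhi, Finset.sum_range_succ', Finset.sum_eq_zero]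
  · simp; ring
  · intro i _
    rw [mulA_iterate_succ_meagre, mul_zero]

/-- Each `compF` strips one vertex off the chain, `mulA` gives `0` at a meagre root, and `mulPhi`
only rescales. After at most three strippings a nonempty chain is left, where `current` is `0`. -/
theorem numerical_tau14 (c : EPIRKW3) : numerical c (some tau14) = 0 := by
  simp [numerical, EPIRKW3.scheme, tau14, mulPhi_meagre, compF, mulA, current]

theorem exact_tau14 : exact (some tau14) = 1 / 24 := by
  norm_num [exact, tau14, allMeagre, forestAllMeagre, density, forestDensity, order, forestOrder]

end BSeries

-- A method satisfying the order conditions up to order three.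

namespace EPIRKW3

/-- A method of order three, all of whose functions `ψ_j` are equal to `φ_1`. -/
noncomputable def thirdOrder : EPIRKW3 where
  -- For `A = 0` this is Heun's method: `Y₂ = y + (2/3) h f(Y₁)`, weights `1/4, 0, 3/4`. The choice
  -- `g11 = 0`, `g21 = 2/3` removes `A f` from the `h²` terms of `Y₁` and `Y₂`; `g31 = 1`, `g32 =
  -- 2/3` and `g33 = 0` then cancel `A f`, `A A f` and `A f' f` in the result.
  a11 := 1 / 3
  a21 := 2 / 3
  a22 := 2 / 3
  b1 := 1
  b2 := 3 / 2
  b3 := 3 / 4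
  g11 := 0
  g21 := 2 / 3
  g22 := 0
  g31 := 1
  g32 := 2 / 3
  g33 := 0
  p11 := 1
  p21 := 1
  p22 := 0
  p31 := 1
  p32 := 0
  p33 := 0

open BSeries TWTree in
theorem thirdOrder_orderConditions : thirdOrder.OrderConditions 3 := by
  intro τ hτ
  rcases τ.eq_of_order_le_three hτ with rfl | rfl | rfl | rfl | rfl | rfl | rfl | rfl
  all_goals
    norm_num [numerical, scheme, thirdOrder, mulPhi_meagre, compF, mulA, current, exact,
      allMeagre, forestAllMeagre, density, forestDensity, order, forestOrder, mulPhi, size,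
      Finset.sum_range_succ, Nat.factorial]

end EPIRKW3

/-! ### The functions `φ_k` -/

section phiOp

variable {E : Type*} [NormedAddCommGroup E] [NormedSpace ℝ E]

/-- The operator function `φ_k(M) = ∑_{i ≥ 0} M^i / (i+k)!` on a normed space. -/
noncomputable def phiOp (k : ℕ) (M : E →L[ℝ] E) : E →L[ℝ] E :=
  ∑' i : ℕ, (((i + k).factorial : ℝ)⁻¹) • M ^ i

variable (M : E →L[ℝ] E)

theorem norm_phiOp_term_le (k i : ℕ) :
    ‖(((i + k).factorial : ℝ)⁻¹) • M ^ i‖ ≤ ‖M‖ ^ i / (i.factorial : ℝ) := by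
  rw [norm_smul, norm_inv, Real.norm_natCast, ← div_eq_inv_mul]
  have h1 : ‖M ^ i‖ ≤ ‖M‖ ^ i := by
    -- The case `i = 0` is separate because `E` may be trivial, so that only `‖1‖ ≤ 1` is available.
    rcases Nat.eq_zero_or_pos i with rfl | hi
    · rw [pow_zero, pow_zero]
      exact ContinuousLinearMap.norm_id_le
    · exact norm_pow_le' M hi
  gcongr
  exact Nat.le_add_right i k

theorem norm_phiOp_le (k : ℕ) (hM : ‖M‖ ≤ 1) : ‖phiOp k M‖ ≤ Real.exp 1 := by
  have h1 := tsum_of_norm_bounded (Real.summable_pow_div_factorial ‖M‖).hasSum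
    (norm_phiOp_term_le M k)
  refine h1.trans ?_
  have h2 := congrFun (Real.exp_eq_exp_ℝ.trans NormedSpace.exp_eq_tsum_div) ‖M‖
  rw [← h2]
  exact Real.exp_le_exp.2 hM

variable [CompleteSpace E]

theorem summable_phiOp (k : ℕ) :
    Summable fun i : ℕ => (((i + k).factorial : ℝ)⁻¹) • M ^ i :=
  Summable.of_norm_bounded (Real.summable_pow_div_factorial ‖M‖) (norm_phiOp_term_le M k)

theorem phiOp_eq_add_mul (k : ℕ) :
    phiOp k M = ((k.factorial : ℝ)⁻¹) • 1 + M * phiOp (k + 1) M := by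
  rw [phiOp, (summable_phiOp M k).tsum_eq_zero_add, phiOp,
    ← (summable_phiOp M (k + 1)).tsum_mul_left]
  congr 1
  · simp
  · refine tsum_congr fun i => ?_
    rw [pow_succ', mul_smul_comm, add_assoc, add_comm 1 k]

/-- Three uses of `φ_k(z) = 1/k! + z φ_{k+1}(z)`. With `M = g h A` and `v = O(h)` the last term is
`O(h⁴)`. -/
theorem phiOp_one_apply (v : E) :
    phiOp 1 M v = v + (1 / 2 : ℝ) • M v + (1 / 6 : ℝ) • M (M v)
      + M (M (M (phiOp 4 M v))) := by
  rw [phiOp_eq_add_mul M 1, phiOp_eq_add_mul M 2, phiOp_eq_add_mul M 3]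
  simp only [Nat.factorial, add_apply, smul_apply, one_apply_eq_self, mul_apply_eq_comp,
    map_add, map_smul]
  norm_num [add_assoc]

theorem phiOp_zero (k : ℕ) : phiOp k (0 : E →L[ℝ] E) = ((k.factorial : ℝ)⁻¹) • 1 := by
  rw [phiOp_eq_add_mul, zero_mul, add_zero]

theorem EPIRKW3.scheme_phiOp_zero {E : Type} [NormedAddCommGroup E] [NormedSpace ℝ E]
    [CompleteSpace E] (c : EPIRKW3) (hf : E → E) (h : ℝ) (y : E) :
    c.scheme hf (fun v => h • (0 : E →L[ℝ] E) v)
        (fun k g v => phiOp k ((g * h) • (0 : E →L[ℝ] E)) v) y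
      = c.scheme hf (fun _ => 0) (fun k _ v => ((k.factorial : ℝ)⁻¹) • v) y := by
  simp only [smul_zero, phiOp_zero, smul_apply, one_apply_eq_self, zero_apply]

end phiOp

/-! ### Failure of order four -/

namespace EPIRKW3

theorem step_eq_scheme_phiOp {N : ℕ} (c : EPIRKW3)
    (f : EuclideanSpace ℝ (Fin N) → EuclideanSpace ℝ (Fin N))
    (A : EuclideanSpace ℝ (Fin N) →L[ℝ] EuclideanSpace ℝ (Fin N)) (h : ℝ)
    (y : EuclideanSpace ℝ (Fin N)) :
    c.step f A h y = c.scheme (fun Y => h • f Y) (fun v => h • A v)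
      (fun k g v => phiOp k ((g * h) • A) v) y :=
  rfl

/-- The right-hand side of the linear chain `y₁' = y₂`, `y₂' = y₃`, `y₃' = y₄`, `y₄' = 1`. -/
noncomputable def chainField (y : EuclideanSpace ℝ (Fin 4)) : EuclideanSpace ℝ (Fin 4) :=
  !₂[y 1, y 2, y 3, 1]

/-- The solution of the chain with initial value `0`. -/
noncomputable def chainSolution (t : ℝ) : EuclideanSpace ℝ (Fin 4) :=
  !₂[t ^ 4 / 24, t ^ 3 / 6, t ^ 2 / 2, t]

theorem contDiff_chainField : ContDiff ℝ ∞ chainField := by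
  rw [contDiff_euclidean]
  intro i
  fin_cases i <;> simp [chainField] <;> fun_prop

theorem hasDerivAt_chainSolution (t : ℝ) :
    HasDerivAt chainSolution (chainField (chainSolution t)) t := by
  have h4 : HasDerivAt (fun t : ℝ => t ^ 4 / 24) (t ^ 3 / 6) t :=
    ((hasDerivAt_pow 4 t).div_const 24).congr_deriv (by norm_num; ring)
  have h3 : HasDerivAt (fun t : ℝ => t ^ 3 / 6) (t ^ 2 / 2) t :=
    ((hasDerivAt_pow 3 t).div_const 6).congr_deriv (by norm_num; ring)
  have h2 : HasDerivAt (fun t : ℝ => t ^ 2 / 2) t t :=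
    ((hasDerivAt_pow 2 t).div_const 2).congr_deriv (by norm_num)
  have h1 : HasDerivAt (fun t : ℝ => ![t ^ 4 / 24, t ^ 3 / 6, t ^ 2 / 2, t])
      ![t ^ 3 / 6, t ^ 2 / 2, t, 1] t := by
    rw [hasDerivAt_pi]
    intro i
    fin_cases i
    exacts [h4, h3, h2, hasDerivAt_id' t]
  exact (PiLp.hasFDerivAt_toLp (𝕜 := ℝ) 2 _).comp_hasDerivAt t h1

/-- With `A = 0` every `ψ_j` is a scalar. Starting from `0`, each nested evaluation of the field
lets one more component become nonzero, from the last upwards; three evaluations do not reach the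
first. -/
theorem step_chainField (c : EPIRKW3) (h : ℝ) : c.step chainField 0 h 0 0 = 0 := by
  rw [step_eq_scheme_phiOp, scheme_phiOp_zero]
  simp [scheme, chainField]

theorem HasOrder.le_three {c : EPIRKW3} {p : ℕ} (hc : c.HasOrder p) : p ≤ 3 := by
  by_contra! hp
  have h1 := hc 4 chainField 0 chainSolution 0 1 contDiff_chainField one_pos
    fun t _ => (hasDerivAt_chainSolution t).hasDerivWithinAt
  have h0 : chainSolution 0 = 0 := by
    ext i; fin_cases i <;> simp [chainSolution]
  rw [h0] at h1
  -- The first component of the error is `-h⁴/24`, whence the constant `24`.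
  have h2 : (fun h : ℝ => h ^ 4) =O[𝓝[>] 0] fun h : ℝ => h ^ (p + 1) := by
    refine (IsBigO.of_bound 24 (Eventually.of_forall fun h => ?_)).trans h1
    have h3 := PiLp.norm_apply_le (c.step chainField 0 h 0 - chainSolution (0 + h)) 0
    rw [PiLp.sub_apply, step_chainField, zero_sub, norm_neg, zero_add] at h3
    have h4 : chainSolution h 0 = h ^ 4 / 24 := rfl
    rw [h4, norm_div, Real.norm_ofNat] at h3
    rw [zero_add]
    linarith
  have h3 : (fun h : ℝ => h ^ (p + 1)) =o[𝓝[>] 0] fun h : ℝ => h ^ 4 :=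
    (isLittleO_pow_pow (by omega)).mono nhdsWithin_le_nhds
  refine isLittleO_irrefl (Eventually.frequently ?_) (h2.trans_isLittleO h3)
  filter_upwards [self_mem_nhdsWithin] with h hh
  exact (pow_pos hh 4).ne'

end EPIRKW3

/-! ### Taylor expansions -/

section Taylor

variable {E G : Type*} [NormedAddCommGroup E] [NormedSpace ℝ E]
  [NormedAddCommGroup G] [NormedSpace ℝ G]

/-- If the derivative is `O(‖x‖^n)` on a convex set, then the function is `O(‖x‖^(n+1))`. -/
theorem isBigO_pow_succ_of_fderiv {R : E → G} {R' : E → E →L[ℝ] G} {s : Set E} {n : ℕ}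
    (hs : Convex ℝ s) (h0 : 0 ∈ s) (hR0 : R 0 = 0)
    (hR : ∀ x ∈ s, HasFDerivWithinAt R (R' x) s x)
    (hR' : R' =O[𝓝[s] 0] fun x => ‖x‖ ^ n) : R =O[𝓝[s] 0] fun x => ‖x‖ ^ (n + 1) := by
  obtain ⟨C, hC0, hC⟩ := hR'.exists_nonneg
  obtain ⟨ε, hε, hb⟩ := Metric.mem_nhdsWithin_iff.1 hC.bound
  refine IsBigO.of_bound C (Metric.mem_nhdsWithin_iff.2 ⟨ε, hε, fun x hx => ?_⟩)
  have hxε : ‖x‖ < ε := by simpa using hx.1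
  -- Mean value inequality on the part of `s` within distance `‖x‖` of `0`, where the derivative is
  -- at most `C ‖x‖ ^ n`.
  have key := Convex.norm_image_sub_le_of_norm_hasFDerivWithin_le (𝕜 := ℝ) (f := R) (f' := R')
    (s := s ∩ Metric.closedBall 0 ‖x‖) (C := C * ‖x‖ ^ n) (x := 0) (y := x)
    (fun z hz => (hR z hz.1).mono Set.inter_subset_left)
    (fun z hz => by
      have hzx : ‖z‖ ≤ ‖x‖ := by simpa using hz.2
      have hz' : ‖R' z‖ ≤ C * ‖‖z‖ ^ n‖ := hb ⟨by simpa using hzx.trans_lt hxε, hz.1⟩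
      rw [norm_pow, norm_norm] at hz'
      refine hz'.trans ?_
      gcongr)
    (hs.inter (convex_closedBall 0 ‖x‖)) ⟨h0, by simp⟩ ⟨hx.2, by simp⟩
  rw [hR0, sub_zero, sub_zero] at key
  simpa [pow_succ, mul_assoc] using key

theorem isBigO_pow_succ_of_deriv {w w' : ℝ → G} {T : ℝ} (hT : 0 < T) {n : ℕ} (h0 : w 0 = 0)
    (hw : ∀ t ∈ Set.Icc 0 T, HasDerivWithinAt w (w' t) (Set.Icc 0 T) t)
    (hw' : w' =O[𝓝[≥] 0] fun t => t ^ n) : w =O[𝓝[≥] 0] fun t => t ^ (n + 1) := by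
  rw [← nhdsWithin_Icc_eq_nhdsGE hT] at *
  have := isBigO_pow_succ_of_fderiv (n := n) (convex_Icc 0 T) ⟨le_rfl, hT.le⟩ h0
    (fun t ht => (hw t ht).hasFDerivWithinAt) ?_
  · simpa only [← norm_pow, isBigO_norm_right] using this
  · simp only [← norm_pow, isBigO_norm_right]
    refine IsBigO.trans (IsBigO.of_bound 1 (Eventually.of_forall fun t => ?_)) hw'
    simp

theorem ContDiff.hasFDerivAt_comp_const_add {f : E → G} (hf : ContDiff ℝ ∞ f) (x v : E) :
    HasFDerivAt (fun v => f (x + v)) (fderiv ℝ f (x + v)) v := by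
  rw [hasFDerivAt_comp_add_left]
  exact (hf.differentiable (by simp) _).hasFDerivAt

theorem isBigO_taylor_two {f : E → G} (hf : ContDiff ℝ ∞ f) (x : E) :
    (fun v => f (x + v) - f x - fderiv ℝ f x v - (1 / 2 : ℝ) • fderiv ℝ (fderiv ℝ f) x v v)
      =O[𝓝 0] fun v => ‖v‖ ^ 3 := by
  have hf1 : ContDiff ℝ ∞ (fderiv ℝ f) := hf.fderiv_right (by simp)
  have hf2 : ContDiff ℝ ∞ (fderiv ℝ (fderiv ℝ f)) := hf1.fderiv_right (by simp)
  have h2 : (fun v => fderiv ℝ (fderiv ℝ f) (x + v) - fderiv ℝ (fderiv ℝ f) x)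
      =O[𝓝 0] fun v => ‖v‖ ^ 1 := by
    have := (hf2.hasFDerivAt_comp_const_add x 0).isBigO_sub
    simpa using this.norm_right
  have h1 : (fun v => fderiv ℝ f (x + v) - fderiv ℝ f x - fderiv ℝ (fderiv ℝ f) x v)
      =O[𝓝 0] fun v => ‖v‖ ^ 2 := by
    rw [← nhdsWithin_univ] at h2 ⊢
    refine isBigO_pow_succ_of_fderiv convex_univ trivial (by simp) (fun v _ => ?_) h2
    exact (((hf1.hasFDerivAt_comp_const_add x v).sub_const _).sub
      (fderiv ℝ (fderiv ℝ f) x).hasFDerivAt).hasFDerivWithinAt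
  rw [← nhdsWithin_univ] at h1 ⊢
  refine isBigO_pow_succ_of_fderiv convex_univ trivial (by simp) (fun v _ => ?_) h1
  have hQ := ((fderiv ℝ (fderiv ℝ f) x).hasFDerivAt (x := v)).clm_apply (hasFDerivAt_id v)
  -- The derivative of `v ↦ ½ Q(v, v)` is `½ (Q(v, ·) + Q(·, v))`; symmetry turns it into `Q(v, ·)`.
  have hsymm : IsSymmSndFDerivAt ℝ f x :=
    hf.contDiffAt.isSymmSndFDerivAt
      (by rw [minSmoothness_of_isRCLikeNormedField]; exact WithTop.coe_le_coe.2 (le_top : (2 : ℕ∞) ≤ ⊤))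
  refine ((((hf.hasFDerivAt_comp_const_add x v).sub_const _).sub
    (fderiv ℝ f x).hasFDerivAt).sub
    (hQ.const_smul (1 / 2 : ℝ))).hasFDerivWithinAt.congr_fderiv ?_
  ext w
  simp only [id, sub_apply, smul_apply, add_apply, ContinuousLinearMap.flip_apply,
    ContinuousLinearMap.comp_apply, ContinuousLinearMap.id_apply, hsymm w v]
  module

end Taylor

theorem isBigO_pow_of_le {m n : ℕ} (h : m ≤ n) :
    (fun t : ℝ => t ^ n) =O[𝓝[≥] 0] fun t => t ^ m := by
  refine IsBigO.of_bound 1 ?_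
  filter_upwards [Icc_mem_nhdsGE (zero_lt_one' ℝ)] with t ht
  rw [one_mul, Real.norm_of_nonneg (pow_nonneg ht.1 n), Real.norm_of_nonneg (pow_nonneg ht.1 m)]
  exact pow_le_pow_of_le_one ht.1 ht.2 h

theorem Asymptotics.IsBigO.of_pow_le {E : Type*} [NormedAddCommGroup E] {v : ℝ → E} {m n : ℕ}
    (hv : v =O[𝓝[≥] 0] fun t : ℝ => t ^ n) (h : m ≤ n) : v =O[𝓝[≥] 0] fun t : ℝ => t ^ m :=
  hv.trans (isBigO_pow_of_le h)

/-! ### Expansions in powers of the step size -/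

section Expansion

variable {E : Type*} [NormedAddCommGroup E] [NormedSpace ℝ E]

theorem isBigO_pow_smul_const (n : ℕ) (a : E) :
    (fun h : ℝ => h ^ n • a) =O[𝓝[≥] 0] fun h => h ^ n :=
  IsBigO.of_bound ‖a‖ (Eventually.of_forall fun h => by rw [norm_smul, mul_comm])

theorem Asymptotics.IsBigO.pow_smul {v : ℝ → E} {n : ℕ} (hv : v =O[𝓝[≥] 0] fun h : ℝ => h ^ n)
    (m : ℕ) : (fun h => h ^ m • v h) =O[𝓝[≥] 0] fun h : ℝ => h ^ (m + n) := by
  simpa only [pow_add, smul_eq_mul] using (isBigO_refl (fun h : ℝ => h ^ m) _).smul hv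

theorem isBigO_bilinear {G : Type*} [NormedAddCommGroup G] [NormedSpace ℝ G]
    (Q : E →L[ℝ] E →L[ℝ] G) {v w : ℝ → E} {m n : ℕ}
    (hv : v =O[𝓝[≥] 0] fun h : ℝ => h ^ m) (hw : w =O[𝓝[≥] 0] fun h : ℝ => h ^ n) :
    (fun h => Q (v h) (w h)) =O[𝓝[≥] 0] fun h : ℝ => h ^ (m + n) := by
  have h1 : (fun h => Q (v h) (w h)) =O[𝓝[≥] 0] fun h => ‖v h‖ * ‖w h‖ :=
    IsBigO.of_bound ‖Q‖ (Eventually.of_forall fun h => by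
      rw [norm_mul, norm_norm, norm_norm, ← mul_assoc]
      exact Q.le_opNorm₂ _ _)
  simpa only [pow_add] using h1.trans (hv.norm_left.mul hw.norm_left)

section Composition

variable {f : E → E} {v : ℝ → E}

theorem isBigO_comp_taylor_two (hf : ContDiff ℝ ∞ f) (y : E)
    (hv : v =O[𝓝[≥] 0] fun h : ℝ => h ^ 1) :
    (fun h => f (y + v h) - f y - fderiv ℝ f y (v h)
      - (1 / 2 : ℝ) • fderiv ℝ (fderiv ℝ f) y (v h) (v h)) =O[𝓝[≥] 0] fun h : ℝ => h ^ 3 := by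
  have h0 : Tendsto v (𝓝[≥] 0) (𝓝 0) := by
    refine hv.trans_tendsto ?_
    simp only [pow_one]
    exact nhdsWithin_le_nhds
  have h1 := (isBigO_taylor_two hf y).comp_tendsto h0
  refine h1.trans ?_
  simp only [pow_one] at hv
  exact hv.norm_left.pow 3

theorem isBigO_comp_sub (hf : ContDiff ℝ ∞ f) (y : E)
    (hv : v =O[𝓝[≥] 0] fun h : ℝ => h ^ 1) :
    (fun h => f (y + v h) - f y) =O[𝓝[≥] 0] fun h : ℝ => h ^ 1 := by
  have h1 := (isBigO_comp_taylor_two hf y hv).of_pow_le (m := 1) (by norm_num)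
  have h2 := ((fderiv ℝ f y).isBigO_comp v _).trans hv
  have h3 := ((isBigO_bilinear (fderiv ℝ (fderiv ℝ f) y) hv hv).of_pow_le (m := 1)
    (by norm_num)).const_smul_left (1 / 2 : ℝ)
  refine ((h1.add h2).add h3).congr_left fun h => ?_
  simp only [Pi.smul_apply]
  module

theorem isBigO_comp_sub_linear (hf : ContDiff ℝ ∞ f) (y : E) {a : E}
    (hv : (fun h => v h - h • a) =O[𝓝[≥] 0] fun h : ℝ => h ^ 2) :
    (fun h => f (y + v h) - (f y + h • fderiv ℝ f y a)) =O[𝓝[≥] 0] fun h : ℝ => h ^ 2 := by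
  have hv1 : v =O[𝓝[≥] 0] fun h : ℝ => h ^ 1 :=
    ((hv.of_pow_le one_le_two).add (isBigO_pow_smul_const 1 a)).congr_left fun h => by simp
  have h1 := (isBigO_comp_taylor_two hf y hv1).of_pow_le (m := 2) (by norm_num)
  have h2 := ((fderiv ℝ f y).isBigO_comp _ _).trans hv
  have h3 := (isBigO_bilinear (fderiv ℝ (fderiv ℝ f) y) hv1 hv1).const_smul_left (1 / 2 : ℝ)
  refine ((h1.add h2).add h3).congr_left fun h => ?_
  simp only [Pi.smul_apply, map_sub, map_smul]
  module

theorem isBigO_comp_sub_quadratic (hf : ContDiff ℝ ∞ f) (y : E) {a b : E}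
    (hv : (fun h => v h - (h • a + h ^ 2 • b)) =O[𝓝[≥] 0] fun h : ℝ => h ^ 3) :
    (fun h => f (y + v h) - (f y + h • fderiv ℝ f y a + h ^ 2 • (fderiv ℝ f y b
      + (1 / 2 : ℝ) • fderiv ℝ (fderiv ℝ f) y a a))) =O[𝓝[≥] 0] fun h : ℝ => h ^ 3 := by
  have hv2 : (fun h => v h - h • a) =O[𝓝[≥] 0] fun h : ℝ => h ^ 2 :=
    ((hv.of_pow_le (m := 2) (by norm_num)).add (isBigO_pow_smul_const 2 b)).congr_left
      fun h => by module
  have ha : (fun h : ℝ => h • a) =O[𝓝[≥] 0] fun h : ℝ => h ^ 1 := by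
    simpa using isBigO_pow_smul_const 1 a
  have hv1 : v =O[𝓝[≥] 0] fun h : ℝ => h ^ 1 :=
    ((hv2.of_pow_le one_le_two).add ha).congr_left fun h => by simp
  have h1 := isBigO_comp_taylor_two hf y hv1
  have h2 := ((fderiv ℝ f y).isBigO_comp _ _).trans hv
  -- `Q(v, v) - h² Q(a, a) = Q(v, v - h a) + Q(v - h a, h a)`, both terms being `O(h³)`.
  have h3 := (isBigO_bilinear (fderiv ℝ (fderiv ℝ f) y) hv1 hv2).const_smul_left (1 / 2 : ℝ)
  have h4 := (isBigO_bilinear (fderiv ℝ (fderiv ℝ f) y) hv2 ha).const_smul_left (1 / 2 : ℝ)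
  refine (((h1.add h2).add h3).add h4).congr_left fun h => ?_
  simp only [Pi.smul_apply, map_sub, map_add, map_smul, sub_apply, smul_apply]
  module

end Composition

/-- `v(h) = h a + h² b + h³ c + O(h⁴)` as `h → 0`, `h ≥ 0`. -/
def HasCubicExpansion (v : ℝ → E) (a b c : E) : Prop :=
  (fun h : ℝ => v h - (h • a + h ^ 2 • b + h ^ 3 • c)) =O[𝓝[≥] 0] fun h : ℝ => h ^ 4

namespace HasCubicExpansion

variable {v w : ℝ → E} {a b c a' b' c' : E}

theorem add (hv : HasCubicExpansion v a b c) (hw : HasCubicExpansion w a' b' c') :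
    HasCubicExpansion (fun h => v h + w h) (a + a') (b + b') (c + c') :=
  (IsBigO.add hv hw).congr_left fun h => by module

theorem sub (hv : HasCubicExpansion v a b c) (hw : HasCubicExpansion w a' b' c') :
    HasCubicExpansion (fun h => v h - w h) (a - a') (b - b') (c - c') :=
  (IsBigO.sub hv hw).congr_left fun h => by module

theorem const_smul (hv : HasCubicExpansion v a b c) (r : ℝ) :
    HasCubicExpansion (fun h => r • v h) (r • a) (r • b) (r • c) :=
  (IsBigO.const_smul_left hv r).congr_left fun h => by simp only [Pi.smul_apply]; module

theorem smul_const (a : E) : HasCubicExpansion (fun h => h • a) a 0 0 :=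
  (isBigO_zero _ _).congr_left fun h => by simp

theorem of_isBigO (hv : v =O[𝓝[≥] 0] fun h : ℝ => h ^ 4) : HasCubicExpansion v 0 0 0 :=
  hv.congr_left fun h => by simp

theorem isBigO_sub_quadratic (hv : HasCubicExpansion v a b c) :
    (fun h => v h - (h • a + h ^ 2 • b)) =O[𝓝[≥] 0] fun h : ℝ => h ^ 3 :=
  ((IsBigO.of_pow_le hv (by norm_num : 3 ≤ 4)).add (isBigO_pow_smul_const 3 c)).congr_left
    fun h => by module

theorem isBigO (hv : HasCubicExpansion v a b c) : v =O[𝓝[≥] 0] fun h : ℝ => h ^ 1 :=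
  (((hv.isBigO_sub_quadratic.of_pow_le (by norm_num : 1 ≤ 3)).add
    (isBigO_pow_smul_const 1 a)).add ((isBigO_pow_smul_const 2 b).of_pow_le
    one_le_two)).congr_left fun h => by module

theorem smul_map (hv : HasCubicExpansion v a b c) (A : E →L[ℝ] E) :
    HasCubicExpansion (fun h => h • A (v h)) 0 (A a) (A b) := by
  have h1 := ((A.isBigO_comp _ _).trans hv.isBigO_sub_quadratic).pow_smul 1
  refine h1.congr_left fun h => ?_
  simp only [map_sub, map_add, map_smul]
  module

/-- The factor `h` gains one power, so `v` matters only modulo `O(h³)` and `c` drops out. -/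
theorem smul_comp {f : E → E} (hf : ContDiff ℝ ∞ f) (y : E) (hv : HasCubicExpansion v a b c) :
    HasCubicExpansion (fun h => h • f (y + v h)) (f y) (fderiv ℝ f y a)
      (fderiv ℝ f y b + (1 / 2 : ℝ) • fderiv ℝ (fderiv ℝ f) y a a) :=
  ((isBigO_comp_sub_quadratic hf y hv.isBigO_sub_quadratic).pow_smul 1).congr_left
    fun h => by module

theorem phiOp_one [CompleteSpace E] (hv : HasCubicExpansion v a b c) (A : E →L[ℝ] E) (g : ℝ) :
    HasCubicExpansion (fun h => phiOp 1 ((g * h) • A) (v h)) a (b + (g / 2) • A a)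
      (c + (g / 2) • A b + (g ^ 2 / 6) • A (A a)) := by
  have hM : ∀ᶠ h in 𝓝[≥] (0 : ℝ), ‖(g * h) • A‖ ≤ 1 := by
    have : Continuous fun h : ℝ => ‖(g * h) • A‖ := by fun_prop
    exact (this.continuousWithinAt.eventually_le_const (by simp))
  have h4 : (fun h => phiOp 4 ((g * h) • A) (v h)) =O[𝓝[≥] 0] fun h : ℝ => h ^ 1 := by
    refine IsBigO.trans (IsBigO.of_bound (Real.exp 1) ?_) hv.isBigO
    filter_upwards [hM] with h hh
    exact ContinuousLinearMap.le_of_opNorm_le _ (norm_phiOp_le _ 4 hh) _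
  have hR := (((((A ∘L A ∘L A).isBigO_comp _ _).trans h4).pow_smul 3).const_smul_left (g ^ 3))
  have h5 := ((hv.add ((hv.smul_map A).const_smul (g / 2))).add
    (((hv.smul_map A).smul_map A).const_smul (g ^ 2 / 6))).add (of_isBigO hR)
  refine h5.congr (fun h => ?_) fun h => rfl
  simp only [phiOp_one_apply, Pi.smul_apply, ContinuousLinearMap.comp_apply, smul_apply, map_smul, map_zero]
  module

end HasCubicExpansion

end Expansion

-- Expansion of the exact solution.

section ExactSolution

variable {E : Type*} [NormedAddCommGroup E] [NormedSpace ℝ E]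

theorem hasDerivAt_cubic (a b c : E) (h : ℝ) :
    HasDerivAt (fun h : ℝ => h • a + h ^ 2 • b + h ^ 3 • c)
      (a + (2 * h) • b + (3 * h ^ 2) • c) h := by
  have h2 : HasDerivAt (fun h : ℝ => h ^ 2) (2 * h) h := by simpa using hasDerivAt_pow 2 h
  have h3 : HasDerivAt (fun h : ℝ => h ^ 3) (3 * h ^ 2) h := by simpa using hasDerivAt_pow 3 h
  simpa using (((hasDerivAt_id' h).smul_const a).fun_add (h2.smul_const b)).fun_add
    (h3.smul_const c)

theorem isBigO_sub_cubic_of_deriv {u u' : ℝ → E} {T : ℝ} (hT : 0 < T) (hu0 : u 0 = 0)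
    (hu : ∀ t ∈ Set.Icc 0 T, HasDerivWithinAt u (u' t) (Set.Icc 0 T) t) {n : ℕ} (a b c : E)
    (hu' : (fun h => u' h - (a + (2 * h) • b + (3 * h ^ 2) • c)) =O[𝓝[≥] 0]
      fun h : ℝ => h ^ n) :
    (fun h => u h - (h • a + h ^ 2 • b + h ^ 3 • c)) =O[𝓝[≥] 0] fun h : ℝ => h ^ (n + 1) :=
  isBigO_pow_succ_of_deriv hT (by simp [hu0])
    (fun t ht => (hu t ht).sub (hasDerivAt_cubic a b c t).hasDerivWithinAt) hu'

/-- The expansion of the exact solution in powers of the step size. -/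
theorem hasCubicExpansion_solution {f : E → E} (hf : ContDiff ℝ ∞ f) (y : E) {u : ℝ → E} {T : ℝ}
    (hT : 0 < T) (hu0 : u 0 = 0)
    (hu : ∀ t ∈ Set.Icc 0 T, HasDerivWithinAt u (f (y + u t)) (Set.Icc 0 T) t) :
    HasCubicExpansion u (f y) ((1 / 2 : ℝ) • fderiv ℝ f y (f y))
      ((1 / 6 : ℝ) • (fderiv ℝ f y (fderiv ℝ f y (f y))
        + fderiv ℝ (fderiv ℝ f) y (f y) (f y))) := by
  -- Picard-type bootstrap: an expansion of `u` gives one of `u' = f(y + u)`, and integrating it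
  -- gains one power of `h`. It starts from boundedness and is run four times.
  have h0 : (fun h => f (y + u h)) =O[𝓝[≥] 0] fun h : ℝ => h ^ 0 := by
    have hc : ContinuousWithinAt (fun h => f (y + u h)) (Set.Ici 0) 0 := by
      rw [ContinuousWithinAt, ← nhdsWithin_Icc_eq_nhdsGE hT]
      exact hf.continuous.continuousAt.comp_continuousWithinAt
        (continuousWithinAt_const.add (hu 0 ⟨le_rfl, hT.le⟩).continuousWithinAt)
    simpa only [pow_zero] using hc.isBigO_one ℝ
  have h1 : u =O[𝓝[≥] 0] fun h : ℝ => h ^ 1 := isBigO_pow_succ_of_deriv hT hu0 hu h0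
  have h2 := isBigO_sub_cubic_of_deriv hT hu0 hu (f y) 0 0
    ((isBigO_comp_sub hf y h1).congr_left fun h => by simp)
  have h3 := isBigO_sub_cubic_of_deriv hT hu0 hu (f y) ((1 / 2 : ℝ) • fderiv ℝ f y (f y)) 0
    ((isBigO_comp_sub_linear hf y (v := u) (a := f y) (h2.congr_left fun h => by simp)).congr_left
      fun h => by module)
  have h4 := isBigO_comp_sub_quadratic hf y (v := u) (a := f y)
    (b := (1 / 2 : ℝ) • fderiv ℝ f y (f y)) (h3.congr_left fun h => by simp)
  refine isBigO_sub_cubic_of_deriv hT hu0 hu _ _ _ (h4.congr_left fun h => ?_)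
  rw [map_smul]
  module

end ExactSolution

-- Expansion of the numerical solution and order three.

namespace EPIRKW3

/-- Rewrites the step in increments `Y_i - y`, the form to which the expansion rules apply; `hA 0 =
0` makes `r(y)` vanish. -/
theorem thirdOrder_scheme {V : Type} [AddCommGroup V] [Module ℝ V] (hf hA : V → V)
    (phi : ℕ → ℝ → V → V) (y : V) (hA0 : hA 0 = 0) {v₁ d₁ v₂ d₂ : V}
    (hv₁ : v₁ = (1 / 3 : ℝ) • phi 1 0 (hf y))
    (hd₁ : d₁ = hf (y + v₁) - hf y - hA v₁)
    (hv₂ : v₂ = (2 / 3 : ℝ) • phi 1 (2 / 3) (hf y) + (2 / 3 : ℝ) • phi 1 0 d₁)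
    (hd₂ : d₂ = hf (y + v₂) - hf y - hA v₂ - d₁ - d₁) :
    thirdOrder.scheme hf hA phi y =
      y + (phi 1 1 (hf y) + (3 / 2 : ℝ) • phi 1 (2 / 3) d₁ + (3 / 4 : ℝ) • phi 1 0 d₂) := by
  subst hd₂ hv₂ hd₁ hv₁
  simp only [scheme, thirdOrder, one_smul, zero_smul, add_zero, add_sub_cancel_left, sub_self,
    hA0, sub_zero, add_assoc]

variable {E : Type} [NormedAddCommGroup E] [NormedSpace ℝ E] [CompleteSpace E]

/-- The expansion of the numerical solution in powers of the step size. -/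
theorem hasCubicExpansion_thirdOrder {f : E → E} (hf : ContDiff ℝ ∞ f) (A : E →L[ℝ] E) (y : E) :
    HasCubicExpansion
      (fun h => thirdOrder.scheme (fun Y => h • f Y) (fun v => h • A v)
        (fun k g v => phiOp k ((g * h) • A) v) y - y)
      (f y) ((1 / 2 : ℝ) • fderiv ℝ f y (f y))
      ((1 / 6 : ℝ) • (fderiv ℝ f y (fderiv ℝ f y (f y))
        + fderiv ℝ (fderiv ℝ f) y (f y) (f y))) := by
  have e := HasCubicExpansion.smul_const (f y)
  have ev₁ := (e.phiOp_one A 0).const_smul (1 / 3)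
  have ed₁ := ((ev₁.smul_comp hf y).sub e).sub (ev₁.smul_map A)
  have ev₂ := ((e.phiOp_one A (2 / 3)).const_smul (2 / 3)).add
    ((ed₁.phiOp_one A 0).const_smul (2 / 3))
  have ed₂ := ((((ev₂.smul_comp hf y).sub e).sub (ev₂.smul_map A)).sub ed₁).sub ed₁
  have eY := ((e.phiOp_one A 1).add ((ed₁.phiOp_one A (2 / 3)).const_smul (3 / 2))).add
    ((ed₂.phiOp_one A 0).const_smul (3 / 4))
  refine IsBigO.congr_left eY fun h => ?_
  beta_reduce
  rw [thirdOrder_scheme (fun Y => h • f Y) (fun v => h • A v)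
    (fun k g v => phiOp k ((g * h) • A) v) y (by simp) rfl rfl rfl rfl, add_sub_cancel_left]
  congr 1
  -- It remains to compare cubic polynomials in `h`; all terms containing `A` cancel.
  simp only [map_add, map_sub, map_smul, map_zero, add_apply, sub_apply, smul_apply,
    zero_apply]
  module

theorem thirdOrder_hasOrder : thirdOrder.HasOrder 3 := by
  intro N f A y t₀ t₁ hf ht hy
  have hT : 0 < t₁ - t₀ := sub_pos.2 ht
  have hu : ∀ t ∈ Set.Icc 0 (t₁ - t₀),
      HasDerivWithinAt (fun h => y (t₀ + h) - y t₀) (f (y t₀ + (y (t₀ + t) - y t₀)))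
        (Set.Icc 0 (t₁ - t₀)) t := by
    intro t ht
    have hm : Set.MapsTo (fun h => t₀ + h) (Set.Icc 0 (t₁ - t₀)) (Set.Icc t₀ t₁) :=
      fun h hh => ⟨by linarith [hh.1], by linarith [hh.2]⟩
    have h1 := (hy _ (hm ht)).scomp t
      ((hasDerivAt_id' t).const_add t₀).hasDerivWithinAt hm
    rw [add_sub_cancel]
    simpa [Function.comp_def] using h1.sub_const (y t₀)
  have h1 := hasCubicExpansion_solution hf (y t₀) hT (by simp) hu
  have h2 := hasCubicExpansion_thirdOrder hf A (y t₀)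
  have h3 := (IsBigO.sub h2 h1).mono (nhdsWithin_mono 0 Set.Ioi_subset_Ici_self)
  refine h3.congr_left fun h => ?_
  rw [step_eq_scheme_phiOp, sub_sub_sub_cancel_right, sub_sub_sub_cancel_right]

end EPIRKW3

theorem mainTheorem6 :
    (∀ c : EPIRKW3,
      BSeries.numerical c (some TWTree.tau14) - BSeries.exact (some TWTree.tau14) = -1 / 24) ∧
    (∀ c : EPIRKW3, ¬ c.OrderConditions 4 ∧ ¬ c.HasOrder 4) ∧
    (∀ (c : EPIRKW3) (p : ℕ), c.OrderConditions p ∨ c.HasOrder p → p ≤ 3) ∧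
    (∃ c : EPIRKW3, c.OrderConditions 3 ∧ c.HasOrder 3) := by
  have h1 : ∀ c : EPIRKW3,
      BSeries.numerical c (some TWTree.tau14) - BSeries.exact (some TWTree.tau14) = -1 / 24 := by
    intro c
    rw [BSeries.numerical_tau14, BSeries.exact_tau14]
    norm_num
  have h2 : ∀ (c : EPIRKW3) (p : ℕ), c.OrderConditions p ∨ c.HasOrder p → p ≤ 3 := by
    rintro c p (hc | hc)
    · by_contra! hp
      have h3 := h1 c
      -- `hp : 3 < p` serves as `tau14.order ≤ p`, because the order computes to `4`.
      rw [hc TWTree.tau14 hp, sub_self] at h3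
      norm_num at h3
    · exact hc.le_three
  exact ⟨h1, fun c => ⟨fun h => absurd (h2 c 4 (.inl h)) (by norm_num),
    fun h => absurd (h2 c 4 (.inr h)) (by norm_num)⟩, h2,
    EPIRKW3.thirdOrder, EPIRKW3.thirdOrder_orderConditions, EPIRKW3.thirdOrder_hasOrder⟩
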